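/- Let $\mathbb F$ be a nonabelian free group of finite rank. For $g\ge 0$ let $H_g=\langle a_1,b_1,\dots,a_g,b_g\rangle$ be the free group of rank $2g$, $\partial_g=[a_1,b_1]\cdots[a_g,b_g]$ and $P_g=\langle\partial_g\rangle$. A genus-$g$ representation of $x\in\mathbb F$ is a homomorphism $h:H_g\to\mathbb F$ with $h(\partial_g)=x$. Two homomorphisms $h,h':H_g\to\mathbb F$ are related by a fractional Dehn twist if either (i) $H_g=A*_CB$ with $C$ cyclic and $\partial_g\in A$, and for some $z\in\mathbb F$ centralizing $h(C)$ we have $h'|_A=h|_A$ and $h'(b)=z\,h(b)\,z^{-1}$ for all $b\in B$; or (ii) $H_g=\langle A,t\mid t^{-1}ct=\phi(c),\ c\in C\rangle$ is an HNN extension, where $\phi:C\to C'$ is an isomorphism between subgroups of $A$, $C$ is cyclic and $\partial_g\in A$, and for some $z\in\mathbb F$ centralizing $h(C)$ we have $h'|_A=h|_A$ and $h'(t)=z\,h(t)$. In both cases $h'(\partial_g)=h(\partial_g)$. Let $\sim$ be the equivalence relation generated by fractional Dehn twists on the set of genus-$g$ representations of a given $x$ (equivalently, on the set of extensions to $H_g$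 of a given homomorphism $P_g\to\mathbb F$). A representation is $\sim$-injective if all representations equivalent to it are injective. Let $f_{\mathbb F}(g)$ be the supremum over $x\in\mathbb F$ of the number of equivalence classes of $\sim$-injective genus-$g$ representations of $x$. A representation $h$ is admissible if it is injective and its image is closed under taking roots in $\mathbb F$. Let $f'_{\mathbb F}(g)$ be the supremum over $x\in\mathbb F$ of the number of subgroups of $\mathbb F$ that are images of admissible genus-$g$ representations of $x$. Let $N(H_g,P_g)$ be the smallest $N\in\{0,1,2,\dots\}\cup\{\infty\}$ for which there is a finite set $\mathcal F$ of proper quotients of $H_g$ such that every homomorphism $P_g\to\mathbb F$ has at most $N$ equivalence classes of extensions to $H_g$ in which no element factors through an element of $\mathcal F$. (It is a theorem of Sela that such a finite $N$ exists.) Then for every $g\ge 0$ $$N(H_g,P_g)\ \ge\ f_{\mathbb F}(g)\ \ge\ f'_{\mathbb F}(g)\ \ge\ 2^g .$$ In particular $N(H_g,P_g)\to\infty$ as $g\to\infty$. -/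

import Mathlib

namespace SurfaceExtension

open scoped commutatorElement

/-- The free group `H_g` of rank `2g`, on generators `a_i` (`Sum.inl i`) and `b_i` (`Sum.inr i`):
the fundamental group of the orientable surface of genus `g` with one boundary component. -/
abbrev SurfaceGroup (g : ℕ) : Type := FreeGroup (Fin g ⊕ Fin g)

/-- The boundary word `∂_g = [a_1, b_1] ⋯ [a_g, b_g]`. -/
def boundary (g : ℕ) : SurfaceGroup g :=
  (List.ofFn fun i : Fin g =>
    ⁅(FreeGroup.of (Sum.inl i) : SurfaceGroup g), FreeGroup.of (Sum.inr i)⁆).prod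

/-- The cyclic subgroup `P_g = ⟨∂_g⟩` of `H_g`. -/
def boundarySubgroup (g : ℕ) : Subgroup (SurfaceGroup g) :=
  Subgroup.zpowers (boundary g)

section Splittings

variable {H : Type*} [Group H]

/-- `H` is the internal amalgamated product `S 0 *_C S 1`: the canonical homomorphism to `H` from
the pushout of the inclusions `C ≤ S 0` and `C ≤ S 1` is an isomorphism. -/
def IsAmalgam (S : Fin 2 → Subgroup H) (C : Subgroup H) : Prop :=
  ∃ hC : ∀ i, C ≤ S i,
    Function.Bijective
      (Monoid.PushoutI.lift (φ := fun i => Subgroup.inclusion (hC i))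
        (fun i => (S i).subtype) C.subtype (fun _ => rfl))

/-- `H` is the internal HNN extension `⟨A, t ∣ t⁻¹ c t = φ c, c ∈ C⟩`, where `φ : C ≃* C'` is an
isomorphism between subgroups of `A`. (Mathlib's `HNNExtension A C' C ψ` has the relations
`t c' t⁻¹ = ψ c'` for `c' ∈ C'`, hence `ψ = φ⁻¹` here.) -/
def IsHNN (A : Subgroup H) (C C' : Subgroup A) (φ : C ≃* C') (t : H) : Prop :=
  ∃ ht : ∀ c' : C', t * A.subtype c' = A.subtype (φ.symm c') * t,
    Function.Bijective (HNNExtension.lift (φ := φ.symm) A.subtype t ht)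

end Splittings

section Extensions

variable {F : Type*} [Group F] {g : ℕ}

/-- `h'` is obtained from `h` by a fractional Dehn twist: the first alternative is the one for
splittings `H_g = A *_C B` (with `A = S 0`, `B = S 1`), the second one is for HNN extensions. -/
def FractionalDehnTwist (h h' : SurfaceGroup g →* F) : Prop :=
  (∃ (S : Fin 2 → Subgroup (SurfaceGroup g)) (C : Subgroup (SurfaceGroup g)) (z : F),
    IsAmalgam S C ∧ IsCyclic C ∧ boundary g ∈ S 0 ∧
    (∀ c ∈ C, Commute z (h c)) ∧
    (∀ a ∈ S 0, h' a = h a) ∧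
    (∀ b ∈ S 1, h' b = z * h b * z⁻¹)) ∨
  (∃ (A : Subgroup (SurfaceGroup g)) (C C' : Subgroup A) (φ : C ≃* C') (t : SurfaceGroup g)
      (z : F),
    IsHNN A C C' φ t ∧ IsCyclic C ∧ boundary g ∈ A ∧
    (∀ c ∈ C, Commute z (h c)) ∧
    (∀ a ∈ A, h' a = h a) ∧
    h' t = z * h t)

/-- The equivalence relation `∼` generated by fractional Dehn twists on a set `E` of homomorphisms
`H_g → F`. It is used for the set of all genus `g` representations of an element and for the set of
all extensions of a homomorphism on `P_g`. -/
def twistSetoid (E : Set (SurfaceGroup g →* F)) : Setoid E :=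
  Relation.EqvGen.setoid fun h h' : E => FractionalDehnTwist h.1 h'.1

/-- The set of genus `g` representations of `x`. -/
def representations (g : ℕ) (x : F) : Set (SurfaceGroup g →* F) :=
  {h | h (boundary g) = x}

/-- A genus `g` representation of `x` is `∼`-injective if all genus `g` representations of `x`
equivalent to it are injective. -/
def IsTwistInjective {x : F} (h : representations g x) : Prop :=
  ∀ h' : representations g x, twistSetoid (representations g x) h' h → Function.Injective h'.1

/-- The number of equivalence classes of `∼`-injective genus `g` representations of `x`. -/
noncomputable def num (g : ℕ) (x : F) : ℕ∞ :=
  Set.encard {c : Quotient (twistSetoid (representations g x)) |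
    ∃ h : representations g x, IsTwistInjective h ∧ Quotient.mk _ h = c}

variable (F) in
/-- `f_F(g)`, the supremum over all `x ∈ F` of the number of equivalence classes of `∼`-injective
genus `g` representations of `x`. -/
noncomputable def f (g : ℕ) : ℕ∞ := ⨆ x : F, num g x

/-- A subgroup is primitive if it is closed under taking roots. -/
def IsPrimitiveSubgroup (S : Subgroup F) : Prop :=
  ∀ (y : F) (n : ℕ), 0 < n → y ^ n ∈ S → y ∈ S

/-- A homomorphism is admissible if it is injective with primitive image. -/
def IsAdmissible (h : SurfaceGroup g →* F) : Prop :=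
  Function.Injective h ∧ IsPrimitiveSubgroup h.range

/-- The number of images of admissible genus `g` representations of `x`. -/
noncomputable def num' (g : ℕ) (x : F) : ℕ∞ :=
  Set.encard {S : Subgroup F | ∃ h ∈ representations g x, IsAdmissible h ∧ h.range = S}

variable (F) in
/-- `f'_F(g)`, the supremum over all `x ∈ F` of the number of images of admissible genus `g`
representations of `x`. -/
noncomputable def f' (g : ℕ) : ℕ∞ := ⨆ x : F, num' g x

/-- A proper quotient `q : H → L` of a group `H`. -/
structure ProperQuotient (H : Type) [Group H] where
  /-- the quotient group -/
  L : Type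
  /-- its group structure -/
  [group : Group L]
  /-- the quotient map -/
  q : H →* L
  surjective : Function.Surjective q
  not_injective : ¬ Function.Injective q

attribute [instance] ProperQuotient.group

/-- `h` factors through the quotient `Q`. -/
def FactorsThrough (h : SurfaceGroup g →* F) (Q : ProperQuotient (SurfaceGroup g)) : Prop :=
  ∃ k : Q.L →* F, h = k.comp Q.q

/-- The set of extensions of `p : P_g → F` to `H_g`. -/
def extensions (p : boundarySubgroup g →* F) : Set (SurfaceGroup g →* F) :=
  {h | h.comp (boundarySubgroup g).subtype = p}

/-- An extension of `p` is solid with respect to `𝓕` if no equivalent extension factors through an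
element of `𝓕`. -/
def IsSolid (𝓕 : Set (ProperQuotient (SurfaceGroup g))) {p : boundarySubgroup g →* F}
    (h : extensions p) : Prop :=
  ∀ h' : extensions p, twistSetoid (extensions p) h' h → ∀ Q ∈ 𝓕, ¬ FactorsThrough h'.1 Q

variable (F) in
/-- `N` is a bound as in Sela's theorem for `(H_g, P_g)`: for some finite set `𝓕` of proper
quotients of `H_g`, each homomorphism `P_g → F` has at most `N` equivalence classes of extensions
to `H_g` that are solid with respect to `𝓕`. -/
def IsSelaBound (g : ℕ) (N : ℕ∞) : Prop :=
  ∃ 𝓕 : Set (ProperQuotient (SurfaceGroup g)), 𝓕.Finite ∧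
    ∀ p : boundarySubgroup g →* F,
      Set.encard {c : Quotient (twistSetoid (extensions p)) |
        ∃ h : extensions p, IsSolid 𝓕 h ∧ Quotient.mk _ h = c} ≤ N

variable (F) in
/-- Sela's number `N(H_g, P_g)`: the smallest bound as in Sela's theorem. -/
noncomputable def selaNumber (g : ℕ) : ℕ∞ := sInf {N : ℕ∞ | IsSelaBound F g N}

end Extensions

end SurfaceExtension

namespace SurfaceExtension

open scoped commutatorElement

/-! ### Injective extensions and Sela's bound -/

section Sela

variable {F : Type*} [Group F] {g : ℕ}

/-! An injective homomorphism factors through no proper quotient, so a `∼`-injective class is solid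
for every finite family of quotients; this gives `f ≤ N`.

For `f' ≤ f`, a twist of an admissible `h` turns out to be `h` precomposed with an automorphism of
`H_g`, so it is again admissible with the same image. If `c ≠ 1` lies in `C` and `z` commutes with
`h c`, then a power of `z` is a power of `h c`, and root-closedness gives `z = h w`; the twist by
`w` is the automorphism. If `C` is trivial, the twist changes nothing, because `H_g` has no
nontrivial free splitting with `∂_g` in the vertex group `A`. Otherwise an endomorphism fixing `∂_g`
would kill the rest of the splitting, contradicting nondegeneracy of the intersection form, which is
read off from the image of `∂_g` in the Heisenberg group (`hom_eq_one_of_comp_eq_one`). Hence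
distinct images give distinct `∼`-injective classes.

For `2 ^ g ≤ f'`, each handle `⟨a, b⟩` contains two different pairs with the same commutator. The `2
^ g` independent choices have the same boundary value, and their images are distinct and root-closed
(`handleHom_isAdmissible`). A root-closed embedding of `H_g` carries them into `F`. -/

lemma extensions_eq_representations (h₀ : SurfaceGroup g →* F) :
    extensions (h₀.comp (boundarySubgroup g).subtype) =
      representations g (h₀ (boundary g)) := by
  ext h
  constructor
  · intro hh
    exact DFunLike.congr_fun hh ⟨boundary g, Subgroup.mem_zpowers _⟩
  · intro hh
    ext ⟨y, n, rfl⟩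
    have hh : h (boundary g) = h₀ (boundary g) := hh
    simp [hh]

lemma encard_twistInjective_le_encard_solid (𝓕 : Set (ProperQuotient (SurfaceGroup g)))
    {E E' : Set (SurfaceGroup g →* F)} (hE : E = E') :
    Set.encard {c : Quotient (twistSetoid E) | ∃ h : E,
      (∀ h' : E, twistSetoid E h' h → Function.Injective h'.1) ∧ Quotient.mk _ h = c} ≤
    Set.encard {c : Quotient (twistSetoid E') | ∃ h : E',
      (∀ h' : E', twistSetoid E' h' h → ∀ Q ∈ 𝓕, ¬ FactorsThrough h'.1 Q) ∧
        Quotient.mk _ h = c} := by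
  subst hE
  refine Set.encard_le_encard ?_
  rintro c ⟨h, hh, rfl⟩
  refine ⟨h, fun h' hh' Q _ ⟨k, hk⟩ => Q.not_injective ?_, rfl⟩
  have := hh h' hh'
  rw [hk] at this
  exact Function.Injective.of_comp (f := k) (by simpa using this)

lemma num_le_of_isSelaBound {N : ℕ∞} (hN : IsSelaBound F g N) (x : F) : num g x ≤ N := by
  obtain ⟨𝓕, -, h𝓕⟩ := hN
  by_cases hx : ∃ h₀ : SurfaceGroup g →* F, h₀ (boundary g) = x
  · obtain ⟨h₀, rfl⟩ := hx
    exact (encard_twistInjective_le_encard_solid 𝓕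
      (extensions_eq_representations h₀).symm).trans (h𝓕 _)
  -- Without a representation of `x` there is no homomorphism on `P_g` to apply the bound to, but
  -- then there is nothing to count.
  · have : {c : Quotient (twistSetoid (representations g x)) |
        ∃ h : representations g x, IsTwistInjective h ∧ Quotient.mk _ h = c} = ∅ := by
      ext c
      simp only [Set.mem_ofPred_eq, Set.mem_empty_iff_false, iff_false]
      rintro ⟨h, -⟩
      exact hx ⟨h.1, h.2⟩
    rw [num, this, Set.encard_empty]
    exact zero_le

lemma f_le_selaNumber (F : Type*) [Group F] (g : ℕ) : f F g ≤ selaNumber F g :=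
  iSup_le fun x => le_sInf fun _ hN => num_le_of_isSelaBound hN x

end Sela

/-! ### Universal properties of splittings, and twist endomorphisms -/

section Splittings

variable {H K : Type*} [Group H] [Group K]

namespace IsAmalgam

variable {S : Fin 2 → Subgroup H} {C : Subgroup H}

lemma hom_ext (hS : IsAmalgam S C) {f f' : H →* K} (h₀ : ∀ a ∈ S 0, f a = f' a)
    (h₁ : ∀ b ∈ S 1, f b = f' b) : f = f' := by
  obtain ⟨hC, hbij⟩ := hS
  refine (MonoidHom.cancel_right hbij.surjective).mp (Monoid.PushoutI.hom_ext_nonempty ?_)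
  intro i
  ext x
  have hx := Monoid.PushoutI.lift_of (φ := fun i => Subgroup.inclusion (hC i))
    (fun i => (S i).subtype) C.subtype (fun _ => rfl) x
  refine (congrArg f hx).trans (Eq.trans ?_ (congrArg f' hx).symm)
  fin_cases i
  · exact h₀ x x.2
  · exact h₁ x x.2

lemma exists_hom (hS : IsAmalgam S C) (f₀ : S 0 →* K) (f₁ : S 1 →* K)
    (hf : ∀ c ∈ C, ∀ h₀ h₁, f₀ ⟨c, h₀⟩ = f₁ ⟨c, h₁⟩) :
    ∃ f : H →* K, (∀ a : S 0, f a = f₀ a) ∧ ∀ b : S 1, f b = f₁ b := by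
  obtain ⟨hC, hbij⟩ := hS
  let e := MulEquiv.ofBijective _ hbij
  let F' : ∀ i, S i →* K := Fin.cons f₀ (Fin.cons f₁ finZeroElim)
  let k : Monoid.PushoutI (fun i => Subgroup.inclusion (hC i)) →* K :=
    Monoid.PushoutI.lift F' (f₀.comp (Subgroup.inclusion (hC 0))) (by
      intro i
      ext ⟨c, hc⟩
      fin_cases i
      · rfl
      · exact (hf c hc _ _).symm)
  have key : ∀ (i : Fin 2) (x : S i), k (e.symm x) = F' i x := by
    intro i x
    have : e.symm x = Monoid.PushoutI.of i x := by
      rw [MulEquiv.symm_apply_eq]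
      exact (Monoid.PushoutI.lift_of (φ := fun i => Subgroup.inclusion (hC i))
        (fun i => (S i).subtype) C.subtype (fun _ => rfl) x).symm
    rw [this]
    exact Monoid.PushoutI.lift_of _ _ _ _
  exact ⟨k.comp e.symm.toMonoidHom, fun a => key 0 a, fun b => key 1 b⟩

lemma exists_twist (hS : IsAmalgam S C) {w : H} (hw : ∀ c ∈ C, Commute w c) :
    ∃ τ : H →* H, (∀ a ∈ S 0, τ a = a) ∧ ∀ b ∈ S 1, τ b = w * b * w⁻¹ := by
  obtain ⟨τ, h₀, h₁⟩ := hS.exists_hom (S 0).subtype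
    ((MulAut.conj w).toMonoidHom.comp (S 1).subtype) (by
      intro c hc h₀ h₁
      simp [(hw c hc).eq])
  exact ⟨τ, fun a ha => h₀ ⟨a, ha⟩, fun b hb => h₁ ⟨b, hb⟩⟩

end IsAmalgam

namespace IsHNN

variable {A : Subgroup H} {C C' : Subgroup A} {φ : C ≃* C'} {t : H}

lemma hom_ext (hA : IsHNN A C C' φ t) {f f' : H →* K} (h₀ : ∀ a ∈ A, f a = f' a)
    (h₁ : f t = f' t) : f = f' := by
  obtain ⟨ht, hbij⟩ := hA
  refine (MonoidHom.cancel_right hbij.surjective).mp (HNNExtension.hom_ext ?_ ?_)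
  · ext ⟨x, hx⟩
    simpa using h₀ x hx
  · simpa using h₁

lemma exists_hom (hA : IsHNN A C C' φ t) (f₀ : A →* K) (s : K)
    (hs : ∀ c' : C', s * f₀ c' = f₀ (φ.symm c') * s) :
    ∃ f : H →* K, (∀ a : A, f a = f₀ a) ∧ f t = s := by
  obtain ⟨ht, hbij⟩ := hA
  let e := MulEquiv.ofBijective _ hbij
  refine ⟨(HNNExtension.lift f₀ s hs).comp e.symm.toMonoidHom, fun a => ?_, ?_⟩
  · have : e.symm a = HNNExtension.of a := by
      rw [MulEquiv.symm_apply_eq]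
      simp [e]
    simp [this]
  · have : e.symm t = HNNExtension.t := by
      rw [MulEquiv.symm_apply_eq]
      simp [e]
    simp [this]

lemma exists_twist (hA : IsHNN A C C' φ t) {w : H} (hw : ∀ c ∈ C, Commute w (c : H)) :
    ∃ τ : H →* H, (∀ a ∈ A, τ a = a) ∧ τ t = w * t := by
  obtain ⟨τ, h₀, h₁⟩ := hA.exists_hom A.subtype (w * t) (by
    intro c'
    obtain ⟨ht, -⟩ := hA
    have h2 := (hw (φ.symm c') (φ.symm c').2).eq
    rw [mul_assoc, ht c', ← mul_assoc, ← mul_assoc]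
    exact congrArg (· * t) h2)
  exact ⟨τ, fun a ha => h₀ ⟨a, ha⟩, h₁⟩

end IsHNN

end Splittings

/-! ### Commuting elements and characters of free groups -/

section FreeGroups

variable {F : Type*} [Group F] [IsFreeGroup F]

lemma isMulTorsionFree_of_isFreeGroup : IsMulTorsionFree F where
  pow_left_injective n hn x y hxy := by
    let e := IsFreeGroup.toFreeGroup F
    apply e.injective
    apply pow_left_injective hn
    simpa using congrArg e hxy

lemma isCyclic_of_isMulCommutative (hF : ∀ x y : F, x * y = y * x) : IsCyclic F := by
  let e := IsFreeGroup.toFreeGroup F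
  have hs : Subsingleton (IsFreeGroup.Generators F) := by
    classical
    refine ⟨fun i j => by_contra fun hij => ?_⟩
    have h1 := congrArg e (hF (e.symm (FreeGroup.of i)) (e.symm (FreeGroup.of j)))
    -- Two distinct generators can be sent to two noncommuting transpositions in `S_3`.
    have h2 := congrArg (FreeGroup.lift fun k =>
      if k = i then Equiv.swap (0 : Fin 3) 1 else Equiv.swap 1 2) h1
    simp [Ne.symm hij] at h2
    revert h2
    decide
  rcases isEmpty_or_nonempty (IsFreeGroup.Generators F) with h | ⟨⟨i⟩⟩
  · have := e.toEquiv.subsingleton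
    infer_instance
  · have := uniqueOfSubsingleton i
    exact isCyclic_of_surjective e.symm e.symm.surjective

/-- The subgroup generated by `y` and `z` is free by Nielsen–Schreier and commutative, hence cyclic.
-/
lemma exists_pow_eq_zpow_of_commute {y z : F} (hyz : Commute z y) (hy : y ≠ 1) :
    ∃ (m : ℕ) (k : ℤ), 0 < m ∧ z ^ m = y ^ k := by
  let K : Subgroup F := Subgroup.closure {z, y}
  have hcomm : ∀ a b : K, a * b = b * a := by
    have := Subgroup.isMulCommutative_closure (k := {z, y}) (by
      rintro a (rfl | rfl) b (rfl | rfl)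
      · rfl
      · exact hyz.eq
      · exact hyz.eq.symm
      · rfl)
    exact fun a b => this.is_comm.comm a b
  obtain ⟨⟨u, hu⟩⟩ := isCyclic_of_isMulCommutative hcomm
  obtain ⟨a, ha⟩ := hu ⟨y, Subgroup.subset_closure (by simp)⟩
  obtain ⟨b, hb⟩ := hu ⟨z, Subgroup.subset_closure (by simp)⟩
  have ha : (u : F) ^ a = y := by simpa using congrArg Subtype.val ha
  have hb : (u : F) ^ b = z := by simpa using congrArg Subtype.val hb
  have ha0 : a ≠ 0 := by
    rintro rfl
    exact hy (by simpa using ha.symm)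
  refine ⟨a.natAbs, b * a.sign, Int.natAbs_pos.mpr ha0, ?_⟩
  rw [← zpow_natCast, ← ha, ← hb, ← zpow_mul, ← zpow_mul]
  congr 1
  rw [Int.natCast_natAbs, ← Int.sign_mul_self_eq_abs]
  ring

lemma eq_one_of_forall_hom_int (hF : ∀ β : F →* Multiplicative ℤ, β = 1) (x : F) : x = 1 := by
  let e := IsFreeGroup.toFreeGroup F
  rcases isEmpty_or_nonempty (IsFreeGroup.Generators F) with h | ⟨⟨i⟩⟩
  · have := e.toEquiv.subsingleton
    exact Subsingleton.elim _ _
  · have h1 := DFunLike.congr_fun (hF ((FreeGroup.lift fun _ => Multiplicative.ofAdd 1).comp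
      e.toMonoidHom)) (e.symm (FreeGroup.of i))
    simp at h1

end FreeGroups

/-! ### The intersection form via the Heisenberg group -/

section Heisenberg

/-- The integral Heisenberg group. -/
@[ext]
structure Heisenberg where
  /-- the first coordinate of the image in the abelianization -/
  fst : ℤ
  /-- the second coordinate of the image in the abelianization -/
  snd : ℤ
  /-- the central coordinate -/
  central : ℤ

namespace Heisenberg

instance : Mul Heisenberg :=
  ⟨fun p q => ⟨p.fst + q.fst, p.snd + q.snd, p.central + q.central + p.fst * q.snd⟩⟩

instance : One Heisenberg := ⟨⟨0, 0, 0⟩⟩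

instance : Inv Heisenberg := ⟨fun p => ⟨-p.fst, -p.snd, -p.central + p.fst * p.snd⟩⟩

@[simp] lemma fst_mul (p q : Heisenberg) : (p * q).fst = p.fst + q.fst := rfl
@[simp] lemma snd_mul (p q : Heisenberg) : (p * q).snd = p.snd + q.snd := rfl
@[simp] lemma central_mul (p q : Heisenberg) :
    (p * q).central = p.central + q.central + p.fst * q.snd := rfl
@[simp] lemma fst_one : (1 : Heisenberg).fst = 0 := rfl
@[simp] lemma snd_one : (1 : Heisenberg).snd = 0 := rfl
@[simp] lemma central_one : (1 : Heisenberg).central = 0 := rfl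
@[simp] lemma fst_inv (p : Heisenberg) : p⁻¹.fst = -p.fst := rfl
@[simp] lemma snd_inv (p : Heisenberg) : p⁻¹.snd = -p.snd := rfl
@[simp] lemma central_inv (p : Heisenberg) : p⁻¹.central = -p.central + p.fst * p.snd := rfl

instance : Group Heisenberg :=
  Group.ofLeftAxioms (fun p q r => by ext <;> simp <;> ring) (fun p => by ext <;> simp)
    (fun p => by ext <;> simp)

/-- The projection to the first coordinate. -/
def fstHom : Heisenberg →* Multiplicative ℤ where
  toFun p := Multiplicative.ofAdd p.fst
  map_one' := rfl
  map_mul' _ _ := rfl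

/-- The inclusion of the centre. -/
def centre : Multiplicative ℤ →* Heisenberg where
  toFun n := ⟨0, 0, n.toAdd⟩
  map_one' := rfl
  map_mul' _ _ := by ext <;> simp

lemma commutator_eq (p q : Heisenberg) :
    ⁅p, q⁆ = centre (Multiplicative.ofAdd (p.fst * q.snd - q.fst * p.snd)) := by
  rw [commutatorElement_def]
  ext
  · simp [centre]
  · simp [centre]
  · simp [centre]
    ring

end Heisenberg

lemma map_boundary {K : Type*} [Group K] {g : ℕ} (h : SurfaceGroup g →* K) :
    h (boundary g) = (List.ofFn fun i : Fin g =>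
      ⁅h (FreeGroup.of (Sum.inl i)), h (FreeGroup.of (Sum.inr i))⁆).prod := by
  rw [boundary, map_list_prod, List.map_ofFn]
  congr 2
  funext i
  simp [map_commutatorElement]

/-- The pair `(α, β)` lifts to the Heisenberg group. There `∂_g` goes to the central element given
by the pairing of `α` and `β`. But `∂_g = r ∂_g` is a product of commutators of elements with first
coordinate `0`, and these commute. -/
lemma intersection_form_eq_zero {g : ℕ} (r : SurfaceGroup g →* SurfaceGroup g)
    (hr : r (boundary g) = boundary g) (α : SurfaceGroup g →* Multiplicative ℤ)
    (hα : ∀ x, α (r x) = 1) (β : Fin g ⊕ Fin g → ℤ) :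
    ∑ i : Fin g, ((α (FreeGroup.of (Sum.inl i))).toAdd * β (Sum.inr i) -
      (α (FreeGroup.of (Sum.inr i))).toAdd * β (Sum.inl i)) = 0 := by
  let ρ : SurfaceGroup g →* Heisenberg :=
    FreeGroup.lift fun x => ⟨(α (FreeGroup.of x)).toAdd, β x, 0⟩
  have hρα : Heisenberg.fstHom.comp ρ = α := by
    ext x
    simp [ρ, Heisenberg.fstHom]
  have h0 : ∀ x, (ρ (r x)).fst = 0 := fun x => by
    have := DFunLike.congr_fun hρα (r x)
    rw [hα] at this
    exact congrArg Multiplicative.toAdd this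
  have h1 : ρ (boundary g) = 1 := by
    rw [← hr, ← MonoidHom.comp_apply, map_boundary]
    have : (fun i : Fin g => ⁅(ρ.comp r) (FreeGroup.of (Sum.inl i)),
        (ρ.comp r) (FreeGroup.of (Sum.inr i))⁆) = fun _ => 1 := by
      funext i
      simp [Heisenberg.commutator_eq, h0]
    rw [this]
    simp
  rw [map_boundary] at h1
  simp only [Heisenberg.commutator_eq] at h1
  have h2 := map_list_prod Heisenberg.centre (List.ofFn fun i : Fin g => Multiplicative.ofAdd
      ((α (FreeGroup.of (Sum.inl i))).toAdd * β (Sum.inr i) -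
      (α (FreeGroup.of (Sum.inr i))).toAdd * β (Sum.inl i)))
  rw [List.map_ofFn] at h2
  have h3 : (List.ofFn (Heisenberg.centre ∘ fun i : Fin g => Multiplicative.ofAdd
      ((α (FreeGroup.of (Sum.inl i))).toAdd * β (Sum.inr i) -
      (α (FreeGroup.of (Sum.inr i))).toAdd * β (Sum.inl i)))).prod = 1 := by
    rw [← h1]
    congr 2
    funext i
    simp [ρ]
  rw [h3, List.prod_ofFn] at h2
  have h4 := congrArg Heisenberg.central h2
  simpa [Heisenberg.centre, mul_comm, eq_comm] using h4

lemma hom_eq_one_of_comp_eq_one {g : ℕ} (r : SurfaceGroup g →* SurfaceGroup g)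
    (hr : r (boundary g) = boundary g) (α : SurfaceGroup g →* Multiplicative ℤ)
    (hα : ∀ x, α (r x) = 1) : α = 1 := by
  have key := intersection_form_eq_zero r hr α hα
  ext x
  rcases x with i | i
  · have := key (Pi.single (Sum.inr i) 1)
    simpa [Pi.single_apply] using this
  · have := key (Pi.single (Sum.inl i) 1)
    simpa [Pi.single_apply] using this

end Heisenberg

/-! ### No free splittings relative to the boundary -/

section TrivialEdgeGroup

variable {g : ℕ}

/-- The retraction `r` onto `S 0` killing `S 1` fixes `∂_g`. Every character of `S 1` extends by `1`
on `S 0` to a character that vanishes on the image of `r`, hence is trivial; a free group without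
nontrivial characters to `ℤ` is trivial. -/
lemma IsAmalgam.eq_one_of_mem {S : Fin 2 → Subgroup (SurfaceGroup g)}
    (hS : IsAmalgam S ⊥) (hg : boundary g ∈ S 0) {b : SurfaceGroup g} (hb : b ∈ S 1) :
    b = 1 := by
  have hone : ∀ {K : Type} [Group K] (f₀ : S 0 →* K) (f₁ : S 1 →* K),
      ∀ c ∈ (⊥ : Subgroup (SurfaceGroup g)), ∀ h₀ h₁, f₀ ⟨c, h₀⟩ = f₁ ⟨c, h₁⟩ := by
    intro K _ f₀ f₁ c hc h₀ h₁
    obtain rfl := Subgroup.mem_bot.mp hc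
    exact (map_one f₀).trans (map_one f₁).symm
  obtain ⟨r, hr₀, hr₁⟩ := hS.exists_hom (S 0).subtype 1 (hone _ _)
  refine congrArg Subtype.val (eq_one_of_forall_hom_int (F := S 1) (fun β => ?_) ⟨b, hb⟩)
  obtain ⟨α, hα₀, hα₁⟩ := hS.exists_hom 1 β (hone _ _)
  have hαr : α.comp r = 1 := hS.hom_ext
    (fun a ha => by simpa [hr₀ ⟨a, ha⟩] using hα₀ ⟨a, ha⟩)
    (fun b hb => by simp [hr₁ ⟨b, hb⟩])
  have hα := hom_eq_one_of_comp_eq_one r (hr₀ ⟨_, hg⟩) α (DFunLike.congr_fun hαr)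
  ext b
  rw [← hα₁, hα]
  rfl

lemma not_isHNN_bot {A : Subgroup (SurfaceGroup g)} {C' : Subgroup A}
    {φ : (⊥ : Subgroup A) ≃* C'} {t : SurfaceGroup g} (hg : boundary g ∈ A) :
    ¬ IsHNN A ⊥ C' φ t := by
  intro hA
  have hone : ∀ {K : Type} [Group K] (f₀ : A →* K) (s : K),
      ∀ c' : C', s * f₀ c' = f₀ (φ.symm c') * s := by
    intro K _ f₀ s c'
    have h1 : φ.symm c' = 1 := Subsingleton.elim _ _
    have h2 : c' = 1 := by simpa using h1
    simp [h2]
  obtain ⟨r, hr₀, hr₁⟩ := hA.exists_hom A.subtype 1 (hone _ _)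
  -- This character counts the exponent of `t`; it dies on the image of `r` but not on `t`.
  obtain ⟨α, hα₀, hα₁⟩ := hA.exists_hom 1 (Multiplicative.ofAdd (1 : ℤ)) (hone _ _)
  have hαr : α.comp r = 1 := hA.hom_ext
    (fun a ha => by simpa [hr₀ ⟨a, ha⟩] using hα₀ ⟨a, ha⟩) (by simp [hr₁])
  have hα := hom_eq_one_of_comp_eq_one r (hr₀ ⟨_, hg⟩) α (DFunLike.congr_fun hαr)
  rw [hα] at hα₁
  exact absurd (congrArg Multiplicative.toAdd hα₁) (by simp)

end TrivialEdgeGroup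

/-! ### Twists of admissible representations are automorphisms of the source -/

section Twists

variable {F : Type*} [Group F] {g : ℕ}

lemma FractionalDehnTwist.symm {h h' : SurfaceGroup g →* F} (hh : FractionalDehnTwist h h') :
    FractionalDehnTwist h' h := by
  rcases hh with ⟨S, C, z, hS, hC, hg, hz, h₀, h₁⟩ | ⟨A, C, C', φ, t, z, hA, hC, hg, hz, h₀, h₁⟩
  · refine Or.inl ⟨S, C, z⁻¹, hS, hC, hg, fun c hc => ?_, fun a ha => (h₀ a ha).symm,
      fun b hb => ?_⟩
    · rw [h₀ c (hS.1 0 hc)]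
      exact (hz c hc).inv_left
    · rw [h₁ b hb]
      group
  · refine Or.inr ⟨A, C, C', φ, t, z⁻¹, hA, hC, hg, fun c hc => ?_, fun a ha => (h₀ a ha).symm, ?_⟩
    · rw [h₀ c c.2]
      exact (hz c hc).inv_left
    · rw [h₁]
      group

variable {H : Type*} [Group H]

lemma exists_preimage_of_commute [IsFreeGroup F] {h : H →* F} (hinj : Function.Injective h)
    (hprim : IsPrimitiveSubgroup h.range) {c : H} (hc : c ≠ 1) {z : F}
    (hz : Commute z (h c)) :
    ∃ (w : H) (m : ℕ) (k : ℤ), h w = z ∧ m ≠ 0 ∧ w ^ m = c ^ k := by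
  obtain ⟨m, k, hm, hmk⟩ := exists_pow_eq_zpow_of_commute hz
    (fun h1 => hc (hinj (h1.trans (map_one h).symm)))
  obtain ⟨w, hw⟩ := hprim z m hm ⟨c ^ k, by rw [hmk, map_zpow]⟩
  exact ⟨w, m, k, hw, hm.ne', hinj (by rw [map_pow, hw, hmk, map_zpow])⟩

/-- Roots are unique. This makes the twists by `w` and `w⁻¹` fix `w`, so that they are mutually
inverse. -/
lemma map_eq_self_of_pow_eq_zpow [IsMulTorsionFree H] {τ : H →* H} {w c : H} {m : ℕ} {k : ℤ}
    (hm : m ≠ 0) (hwc : w ^ m = c ^ k) (hc : τ c = c) : τ w = w :=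
  pow_left_injective hm (by simp only; rw [← map_pow, hwc, map_zpow, hc])

lemma IsAdmissible.comp_of_leftInverse {h : SurfaceGroup g →* F} (hh : IsAdmissible h)
    {τ σ : SurfaceGroup g →* SurfaceGroup g} (hστ : σ.comp τ = MonoidHom.id _)
    (hτσ : τ.comp σ = MonoidHom.id _) :
    IsAdmissible (h.comp τ) ∧ (h.comp τ).range = h.range := by
  have hr : (h.comp τ).range = h.range := by
    rw [MonoidHom.range_comp, MonoidHom.range_eq_top.mpr, MonoidHom.range_eq_map]
    exact fun x => ⟨σ x, DFunLike.congr_fun hτσ x⟩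
  refine ⟨⟨hh.1.comp ?_, hr ▸ hh.2⟩, hr⟩
  exact Function.LeftInverse.injective (g := σ) (DFunLike.congr_fun hστ)

lemma IsAdmissible.of_fractionalDehnTwist [IsFreeGroup F] {h h' : SurfaceGroup g →* F}
    (hh : IsAdmissible h) (htw : FractionalDehnTwist h h') :
    IsAdmissible h' ∧ h'.range = h.range := by
  have hcomm : ∀ {w c : SurfaceGroup g}, Commute (h w) (h c) → Commute w c := fun hwc =>
    hh.1 (by simpa using hwc.eq)
  rcases htw with
    ⟨S, C, z, hS, -, hg, hz, h₀, h₁⟩ | ⟨A, C, C', φ, t, z, hA, -, hg, hz, h₀, h₁⟩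
  · rcases C.bot_or_exists_ne_one with rfl | ⟨c, hcC, hc⟩
    · have : h' = h := hS.hom_ext h₀ fun b hb => by
        obtain rfl := hS.eq_one_of_mem hg hb
        simp
      subst this
      exact ⟨hh, rfl⟩
    obtain ⟨w, m, k, rfl, hm, hwc⟩ := exists_preimage_of_commute hh.1 hh.2 hc (hz c hcC)
    have hw : ∀ c ∈ C, Commute w c := fun c hc => hcomm (hz c hc)
    obtain ⟨τ, hτ₀, hτ₁⟩ := hS.exists_twist hw
    obtain ⟨σ, hσ₀, hσ₁⟩ := hS.exists_twist (w := w⁻¹) fun c hc => (hw c hc).inv_left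
    have hτw := map_eq_self_of_pow_eq_zpow hm hwc (hτ₀ c (hS.1 0 hcC))
    have hσw := map_eq_self_of_pow_eq_zpow hm hwc (hσ₀ c (hS.1 0 hcC))
    have hh' : h' = h.comp τ := hS.hom_ext (fun a ha => by simp [h₀ a ha, hτ₀ a ha])
      (fun b hb => by simp [h₁ b hb, hτ₁ b hb])
    rw [hh']
    refine hh.comp_of_leftInverse (σ := σ) ?_ ?_
    · refine hS.hom_ext (fun a ha => by simp [hτ₀ a ha, hσ₀ a ha]) fun b hb => ?_
      simp [hτ₁ b hb, hσ₁ b hb, hσw, mul_assoc]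
    · refine hS.hom_ext (fun a ha => by simp [hτ₀ a ha, hσ₀ a ha]) fun b hb => ?_
      simp [hτ₁ b hb, hσ₁ b hb, hτw, mul_assoc]
  · rcases C.bot_or_exists_ne_one with rfl | ⟨c, hcC, hc⟩
    · exact absurd hA (not_isHNN_bot hg)
    obtain ⟨w, m, k, rfl, hm, hwc⟩ := exists_preimage_of_commute hh.1 hh.2
      (c := (c : SurfaceGroup g)) (by simpa using hc) (hz c hcC)
    have hw : ∀ c ∈ C, Commute w (c : SurfaceGroup g) := fun c hc => hcomm (hz c hc)
    obtain ⟨τ, hτ₀, hτ₁⟩ := hA.exists_twist hw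
    obtain ⟨σ, hσ₀, hσ₁⟩ := hA.exists_twist (w := w⁻¹) fun c hc => (hw c hc).inv_left
    have hτw := map_eq_self_of_pow_eq_zpow hm hwc (hτ₀ c c.2)
    have hσw := map_eq_self_of_pow_eq_zpow hm hwc (hσ₀ c c.2)
    have hh' : h' = h.comp τ := hA.hom_ext (fun a ha => by simp [h₀ a ha, hτ₀ a ha])
      (by simp [h₁, hτ₁])
    rw [hh']
    refine hh.comp_of_leftInverse (σ := σ) ?_ ?_
    · exact hA.hom_ext (fun a ha => by simp [hτ₀ a ha, hσ₀ a ha]) (by simp [hτ₁, hσ₁, hσw])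
    · exact hA.hom_ext (fun a ha => by simp [hτ₀ a ha, hσ₀ a ha]) (by simp [hτ₁, hσ₁, hτw])

lemma isAdmissible_iff_of_twistSetoid [IsFreeGroup F] {E : Set (SurfaceGroup g →* F)} {h h' : E}
    (hhh' : twistSetoid E h h') :
    (IsAdmissible h.1 ↔ IsAdmissible h'.1) ∧ (IsAdmissible h.1 → h.1.range = h'.1.range) := by
  induction hhh' with
  | rel h h' hr =>
    refine ⟨⟨fun hh => (hh.of_fractionalDehnTwist hr).1,
      fun hh => (hh.of_fractionalDehnTwist hr.symm).1⟩,
      fun hh => (hh.of_fractionalDehnTwist hr).2.symm⟩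
  | refl h => exact ⟨Iff.rfl, fun _ => rfl⟩
  | symm h h' _ ih => exact ⟨ih.1.symm, fun hh => (ih.2 (ih.1.mpr hh)).symm⟩
  | trans h h' h'' _ _ ih ih' =>
    exact ⟨ih.1.trans ih'.1, fun hh => (ih.2 hh).trans (ih'.2 (ih.1.mp hh))⟩

lemma num'_le_num [IsFreeGroup F] (g : ℕ) (x : F) : num' g x ≤ num g x := by
  let T : Set (Subgroup F) := {S | ∃ h ∈ representations g x, IsAdmissible h ∧ h.range = S}
  have hT : ∀ S : T, ∃ h : representations g x, IsAdmissible h.1 ∧ h.1.range = S := by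
    rintro ⟨S, h, hx, ha, hS⟩
    exact ⟨⟨h, hx⟩, ha, hS⟩
  choose h ha hr using hT
  let q : T → Quotient (twistSetoid (representations g x)) := fun S => Quotient.mk _ (h S)
  have hq : Function.Injective q := by
    intro S S' hSS'
    apply Subtype.ext
    rw [← hr S, ← hr S']
    exact (isAdmissible_iff_of_twistSetoid (Quotient.exact hSS')).2 (ha S)
  calc num' g x = (Set.range q).encard := by
        rw [← Set.image_univ, hq.encard_image, Set.encard_univ]
        rfl
    _ ≤ num g x := by
      refine Set.encard_le_encard ?_
      rintro _ ⟨S, rfl⟩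
      exact ⟨h S, fun h' hh' => ((isAdmissible_iff_of_twistSetoid hh').1.mpr (ha S)).1, rfl⟩

lemma f'_le_f (F : Type*) [Group F] [IsFreeGroup F] (g : ℕ) : f' F g ≤ f F g :=
  iSup_mono fun x => num'_le_num g x

end Twists

/-! ### A criterion for root-closed images -/

section Retractions

/-- A criterion for a homomorphism `h : H → T` to be injective with root-closed image: some
`j : T → N ⋊ Q` with `Q` torsion-free maps the image into `N` in such a way that `N` retracts to
`H`. -/
lemma injective_and_isPrimitive_of_semidirectProduct {H T N Q : Type*} [Group H] [Group T]
    [Group N] [Group Q] [IsMulTorsionFree T] [IsMulTorsionFree Q] {φ : Q →* MulAut N}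
    {h : H →* T} {j : T →* N ⋊[φ] Q} {k : H →* N} {ρ : N →* H}
    (hjk : j.comp h = SemidirectProduct.inl.comp k) (hρk : ρ.comp k = MonoidHom.id H) :
    Function.Injective h ∧ IsPrimitiveSubgroup h.range := by
  have hjk' : ∀ x, j (h x) = SemidirectProduct.inl (k x) := DFunLike.congr_fun hjk
  have hρk' : ∀ x, ρ (k x) = x := DFunLike.congr_fun hρk
  refine ⟨fun x y hxy => ?_, fun y n hn => ?_⟩
  · have : SemidirectProduct.inl (φ := φ) (k x) = SemidirectProduct.inl (k y) := by
      rw [← hjk', hxy, hjk']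
    rw [← hρk' x, SemidirectProduct.inl_injective this, hρk']
  · rintro ⟨w, hw⟩
    have hj : (j y) ^ n = SemidirectProduct.inl (k w) := by rw [← map_pow, ← hw, hjk']
    -- As `Q` is torsion-free, the root `y` maps into `N`, and `ρ` then produces a root of `w`.
    -- Injectivity of `j` is not needed, since roots in `T` are unique.
    have hright : SemidirectProduct.rightHom (j y) = 1 := by
      refine (pow_eq_one_iff_left hn.ne').mp ?_
      rw [← map_pow, hj]
      simp
    obtain ⟨m, hm⟩ : j y ∈ (SemidirectProduct.inl : N →* N ⋊[φ] Q).range := by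
      rw [SemidirectProduct.range_inl_eq_ker_rightHom]
      exact hright
    rw [← hm, ← map_pow] at hj
    refine ⟨ρ m, pow_left_injective hn.ne' ?_⟩
    simp only
    rw [← hw, ← map_pow, ← map_pow, SemidirectProduct.inl_injective hj, hρk']

lemma IsPrimitiveSubgroup.range_comp {H T F : Type*} [Group H] [Group T] [Group F]
    {e : T →* F} {h : H →* T} (he : Function.Injective e) (hpe : IsPrimitiveSubgroup e.range)
    (hph : IsPrimitiveSubgroup h.range) : IsPrimitiveSubgroup (e.comp h).range := by
  rintro y n hn ⟨w, hw⟩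
  obtain ⟨t, rfl⟩ := hpe y n hn ⟨h w, hw⟩
  obtain ⟨v, rfl⟩ := hph t n hn ⟨w, he (by simpa using hw)⟩
  exact ⟨v, rfl⟩

/-- A group acts on the free group on `Q × X` through its left translations on `Q`. -/
def translation (Q X : Type*) [Group Q] : Q →* MulAut (FreeGroup (Q × X)) where
  toFun q := FreeGroup.freeGroupCongr ((Equiv.mulLeft q).prodCongr (Equiv.refl X))
  map_one' := by
    apply MulEquiv.toMonoidHom_injective
    ext x
    simp
  map_mul' q q' := by
    apply MulEquiv.toMonoidHom_injective
    ext ⟨p, x⟩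
    simp [mul_assoc]

@[simp]
lemma translation_of {Q X : Type*} [Group Q] (q q' : Q) (x : X) :
    translation Q X q (FreeGroup.of (q', x)) = FreeGroup.of (q * q', x) := by
  simp [translation]

@[simp]
lemma translation_symm_of {Q X : Type*} [Group Q] (q q' : Q) (x : X) :
    (translation Q X q).symm (FreeGroup.of (q', x)) = FreeGroup.of (q⁻¹ * q', x) := by
  rw [MulEquiv.symm_apply_eq]
  simp

/-- The semidirect product of the free group on `Q × X` and `Q`, that is the free product of `Q`
and the free group on `X`. -/
abbrev TranslationProduct (Q X : Type*) [Group Q] : Type _ :=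
  FreeGroup (Q × X) ⋊[translation Q X] Q

end Retractions

/-! ### Root-closed free subgroups -/

section Embedding

variable {F : Type*} [Group F] [IsFreeGroup F]

lemma exists_ne_generators (hF : ∃ x y : F, x * y ≠ y * x) :
    ∃ i j : IsFreeGroup.Generators F, i ≠ j := by
  by_contra! hij
  obtain ⟨x, y, hxy⟩ := hF
  apply hxy
  let e := IsFreeGroup.toFreeGroup F
  rcases isEmpty_or_nonempty (IsFreeGroup.Generators F) with h | ⟨⟨i⟩⟩
  · have := e.toEquiv.subsingleton
    exact Subsingleton.elim _ _
  · have : Unique (IsFreeGroup.Generators F) := ⟨⟨i⟩, fun j => hij j i⟩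
    have : IsCyclic F := isCyclic_of_surjective e.symm e.symm.surjective
    exact IsCyclic.isMulCommutative.is_comm.comm x y

/-- A free group on finitely many letters embeds in every nonabelian free group with root-closed
image. -/
lemma exists_injective_isPrimitive (hF : ∃ x y : F, x * y ≠ y * x) (X : Type) [Countable X] :
    ∃ e : FreeGroup X →* F, Function.Injective e ∧ IsPrimitiveSubgroup e.range := by
  classical
  have := isMulTorsionFree_of_isFreeGroup (F := F)
  obtain ⟨a, b, hab⟩ := exists_ne_generators hF
  obtain ⟨ν, hν⟩ := Countable.exists_injective_nat X
  let s : X → Multiplicative ℤ := fun x => Multiplicative.ofAdd (ν x : ℤ)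
  have hs : Function.Injective s := fun x y hxy => hν (by simpa [s] using hxy)
  let A : F := IsFreeGroup.of a
  let B : F := IsFreeGroup.of b
  -- Distinct conjugates of `A` by powers of `B` are part of a basis of the normal closure of `A` in
  -- `⟨A, B⟩`; `ρ` kills the remaining basis elements.
  let e : FreeGroup X →* F := FreeGroup.lift fun x => B ^ ν x * A * (B ^ ν x)⁻¹
  let k : FreeGroup X →* FreeGroup (Multiplicative ℤ × Unit) :=
    FreeGroup.lift fun x => FreeGroup.of (s x, ())
  let ρ : FreeGroup (Multiplicative ℤ × Unit) →* FreeGroup X := FreeGroup.lift fun p =>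
    if h : ∃ x, s x = p.1 then FreeGroup.of h.choose else 1
  let j : F →* TranslationProduct (Multiplicative ℤ) Unit := IsFreeGroup.lift fun i =>
    if i = a then SemidirectProduct.inl (FreeGroup.of (1, ()))
    else if i = b then SemidirectProduct.inr (Multiplicative.ofAdd 1) else 1
  have hjA : j A = SemidirectProduct.inl (FreeGroup.of (1, ())) := by
    simp [j, A]
  have hjB : j B = SemidirectProduct.inr (Multiplicative.ofAdd 1) := by
    simp [j, B, hab.symm]
  refine ⟨e, injective_and_isPrimitive_of_semidirectProduct (j := j) (k := k) (ρ := ρ) ?_ ?_⟩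
  · refine FreeGroup.ext_hom _ _ fun x => ?_
    have hx : s x = Multiplicative.ofAdd (1 : ℤ) ^ ν x := by
      rw [← ofAdd_nsmul]
      simp [s]
    simp only [MonoidHom.comp_apply, e, k, FreeGroup.lift_apply_of, map_mul, map_inv, map_pow,
      hjA, hjB]
    rw [← map_pow, ← hx, ← map_inv, ← SemidirectProduct.inl_aut]
    simp
  · refine FreeGroup.ext_hom _ _ fun x => ?_
    have hx : ∃ x', s x' = s x := ⟨x, rfl⟩
    have hx' : hx.choose = x := hs hx.choose_spec
    simp [k, ρ, hx']

end Embedding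

/-! ### The `2 ^ g` admissible representations -/

section Family

variable {g : ℕ}

/-- For each of the two values of `ε i`, the `i`-th handle is mapped to one of two handles with the
same commutator. -/
def handleHom (ε : Fin g → Bool) : SurfaceGroup g →* SurfaceGroup g :=
  FreeGroup.lift <| Sum.elim
    (fun i =>
      let a : SurfaceGroup g := FreeGroup.of (Sum.inl i)
      let b : SurfaceGroup g := FreeGroup.of (Sum.inr i)
      if ε i then a * b * b else a * b * b * b * a * a)
    (fun i =>
      let a : SurfaceGroup g := FreeGroup.of (Sum.inl i)
      let b : SurfaceGroup g := FreeGroup.of (Sum.inr i)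
      if ε i then b * a * a * b * b * b else b * a)

/-- Both choices have commutator `a b³ a² b a⁻¹ b⁻³ a⁻² b⁻¹`. -/
lemma handleHom_boundary (ε ε' : Fin g → Bool) :
    handleHom ε (boundary g) = handleHom ε' (boundary g) := by
  rw [map_boundary, map_boundary]
  congr 2
  funext i
  cases h : ε i <;> cases h' : ε' i <;>
    simp [handleHom, h, h', commutatorElement_def, mul_assoc]

lemma handleHom_range_injective :
    Function.Injective fun ε : Fin g → Bool => (handleHom ε).range := by
  intro ε ε' hεε'
  have key : ∀ ε ε' : Fin g → Bool, (handleHom ε).range = (handleHom ε').range →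
      ∀ i, ε i = true → ε' i = true := by
    intro ε ε' hr i hi
    by_contra hi'
    -- With `a_i ↦ 1`, `b_i ↦ -1`, both words of the `false` handle have exponent sum `0`, while `a
    -- b b` has `-1`.
    let θ : SurfaceGroup g →* Multiplicative ℤ := FreeGroup.lift <| Sum.elim
      (Pi.mulSingle i (Multiplicative.ofAdd 1)) (Pi.mulSingle i (Multiplicative.ofAdd (-1)))
    have hθ : θ.comp (handleHom ε') = 1 := by
      refine FreeGroup.ext_hom _ _ fun x => ?_
      rcases x with l | l <;> rcases eq_or_ne l i with rfl | hl <;> cases h : ε' l <;>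
        simp_all [θ, handleHom]
    have hmem : handleHom ε (FreeGroup.of (Sum.inl i)) ∈ (handleHom ε').range :=
      hr ▸ ⟨_, rfl⟩
    obtain ⟨y, hy⟩ := hmem
    have h1 : θ (handleHom ε (FreeGroup.of (Sum.inl i))) = 1 := by
      rw [← hy]
      exact DFunLike.congr_fun hθ y
    simp [θ, handleHom, hi] at h1
  funext i
  exact Bool.eq_iff_iff.mpr ⟨key ε ε' hεε' i, key ε' ε hεε'.symm i⟩

lemma handleHom_isAdmissible (ε : Fin g → Bool) : IsAdmissible (handleHom ε) := by
  classical
  let t : Fin g → FreeGroup (Fin g) := FreeGroup.of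
  let c : FreeGroup (Fin g) → Fin g → FreeGroup (FreeGroup (Fin g) × Fin g) :=
    fun q i => FreeGroup.of (q, i)
  have ht : ∀ i, t i ≠ 1 := fun i => FreeGroup.of_ne_one i
  have ht' : ∀ i, (t i)⁻¹ ≠ t i := fun i h =>
    ht i ((pow_eq_one_iff_left two_ne_zero).mp
      ((pow_two _).trans (eq_inv_iff_mul_eq_one.mp h.symm)))
  let T : Fin g → TranslationProduct (FreeGroup (Fin g)) (Fin g) :=
    fun i => SemidirectProduct.inr (t i)
  let X : Fin g → TranslationProduct (FreeGroup (Fin g)) (Fin g) :=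
    fun i => SemidirectProduct.inl (c 1 i)
  -- In the coordinates `b = T`, `a = X T⁻²` (for `true`) or `a = T`, `b = X T⁻¹` (for `false`),
  -- both words become products of conjugates of `X` by `1`, `T` and `T⁻¹`. Then `ρ` kills the
  -- conjugate by `T⁻¹` and solves for `a` and `b` from the other two.
  let j : SurfaceGroup g →* TranslationProduct (FreeGroup (Fin g)) (Fin g) :=
    FreeGroup.lift <| Sum.elim
    (fun i => if ε i then X i * (T i)⁻¹ * (T i)⁻¹ else T i)
    (fun i => if ε i then T i else X i * (T i)⁻¹)
  let k : SurfaceGroup g →* FreeGroup (FreeGroup (Fin g) × Fin g) := FreeGroup.lift <| Sum.elim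
    (fun i => if ε i then c 1 i else c (t i) i * c 1 i * c (t i)⁻¹ i)
    (fun i => if ε i then c (t i) i * c (t i)⁻¹ i else c 1 i)
  let ρ : FreeGroup (FreeGroup (Fin g) × Fin g) →* SurfaceGroup g := FreeGroup.lift fun p =>
    let a : SurfaceGroup g := FreeGroup.of (Sum.inl p.2)
    let b : SurfaceGroup g := FreeGroup.of (Sum.inr p.2)
    if p.1 = 1 then (if ε p.2 then a else b)
    else if p.1 = t p.2 then (if ε p.2 then b else a * b⁻¹) else 1
  refine injective_and_isPrimitive_of_semidirectProduct (j := j) (k := k) (ρ := ρ) ?_ ?_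
  · refine FreeGroup.ext_hom _ _ fun x => ?_
    rcases x with i | i <;> cases h : ε i <;>
      ext <;> simp [handleHom, j, k, h, T, X, c, mul_assoc]
  · refine FreeGroup.ext_hom _ _ fun x => ?_
    rcases x with i | i <;> cases h : ε i <;>
      simp [k, ρ, c, h, ht, ht']

end Family

lemma two_pow_le_f' {F : Type*} [Group F] [IsFreeGroup F] (hF : ∃ x y : F, x * y ≠ y * x)
    (g : ℕ) : (2 : ℕ∞) ^ g ≤ f' F g := by
  obtain ⟨e, he, hpe⟩ := exists_injective_isPrimitive hF (Fin g ⊕ Fin g)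
  let R : (Fin g → Bool) → Subgroup F := fun ε => (e.comp (handleHom ε)).range
  have hR : Function.Injective R := by
    intro ε ε' h
    apply handleHom_range_injective
    apply Subgroup.map_injective he
    simpa [R, MonoidHom.range_comp] using h
  calc (2 : ℕ∞) ^ g = (Set.range R).encard := by
        rw [← Set.image_univ, hR.encard_image, Set.encard_univ]
        simp
    _ ≤ num' g (e (handleHom (fun _ => true) (boundary g))) := by
        refine Set.encard_le_encard ?_
        rintro _ ⟨ε, rfl⟩
        have hε := handleHom_isAdmissible ε
        exact ⟨e.comp (handleHom ε), congrArg e (handleHom_boundary ε _),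
          ⟨he.comp hε.1, IsPrimitiveSubgroup.range_comp he hpe hε.2⟩, rfl⟩
    _ ≤ f' F g := le_iSup (fun x : F => num' g x) _

end SurfaceExtension

theorem mainTheorem2 (F : Type*) [Group F] [IsFreeGroup F] [Group.FG F]
    (hF : ∃ x y : F, x * y ≠ y * x) :
    (∀ g : ℕ,
      SurfaceExtension.f F g ≤ SurfaceExtension.selaNumber F g ∧
      SurfaceExtension.f' F g ≤ SurfaceExtension.f F g ∧
      (2 : ℕ∞) ^ g ≤ SurfaceExtension.f' F g) ∧
    Filter.Tendsto (fun g : ℕ => SurfaceExtension.selaNumber F g) Filter.atTop (nhds (⊤ : ℕ∞)) := by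
  have key : ∀ g : ℕ,
      SurfaceExtension.f F g ≤ SurfaceExtension.selaNumber F g ∧
      SurfaceExtension.f' F g ≤ SurfaceExtension.f F g ∧
      (2 : ℕ∞) ^ g ≤ SurfaceExtension.f' F g := fun g =>
    ⟨SurfaceExtension.f_le_selaNumber F g, SurfaceExtension.f'_le_f F g,
      SurfaceExtension.two_pow_le_f' hF g⟩
  refine ⟨key, ENat.tendsto_nhds_top_iff_natCast_lt.mpr fun n => ?_⟩
  filter_upwards [Filter.eventually_ge_atTop n] with g hg
  calc (n : ℕ∞) < ((2 ^ g : ℕ) : ℕ∞) := by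
        exact_mod_cast hg.trans_lt Nat.lt_two_pow_self
    _ = (2 : ℕ∞) ^ g := by push_cast; rfl
    _ ≤ SurfaceExtension.selaNumber F g := (key g).2.2.trans ((key g).2.1.trans (key g).1)
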